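/- For finite graphs $G,H_1,H_2$ write $G\to(H_1,H_2)$ if every colouring of the edges of $G$ with the colours blue and red contains a blue copy of $H_1$ or a red copy of $H_2$ (copies need not be induced). Let $\mathcal T(n,D)$ be the class of all trees with $n$ edges and maximum degree at most $D$, and write $G\to(K_{r+1},\mathcal T(n,D))$ if $G\to(K_{r+1},T)$ for every $T\in\mathcal T(n,D)$. Let $G(N,p)$ be the binomial random graph on $N$ vertices in which each pair of vertices is an edge independently with probability $p$. **Theorem.** For all integers $r,D\geq 2$ and every real $\varepsilon>0$ there exists a constant $C=C(r,D,\varepsilon)>0$ such that the following holds. Let $p=p(n)\in[0,1]$ and $N=N(n)\in\mathbb N$ satisfy, for all sufficiently large $n$, $$p(n)\geq C\,n^{-2/(r+1)}\qquad\text{and}\qquad N(n)\geq rn+\varepsilon n .$$ Then $$\lim_{n\to\infty}\mathbb P\Big(G\big(N(n),p(n)\big)\to\big(K_{r+1},\mathcal T(n,D)\big)\Big)=1 .$$ -/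

import Mathlib

/-- The two colours used for colouring the edges of a graph. -/
inductive EdgeColour : Type
  | blue : EdgeColour
  | red : EdgeColour

/-- `G → (H₁, H₂)`: every blue-red colouring of the edges of `G` contains a blue copy of `H₁` or a
red copy of `H₂`. Copies are not necessarily induced. -/
def RamseyArrow {V W₁ W₂ : Type*} (G : SimpleGraph V) (H₁ : SimpleGraph W₁)
    (H₂ : SimpleGraph W₂) : Prop :=
  ∀ c : G.EdgeLabeling EdgeColour,
    H₁.IsContained (c.labelGraph EdgeColour.blue) ∨ H₂.IsContained (c.labelGraph EdgeColour.red)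

/-- `T ∈ 𝒯(n, D)`: the finite graph `T` is a tree with `n` edges and maximum degree at most `D`. -/
structure IsBoundedDegreeTree {W : Type*} [Finite W] (T : SimpleGraph W) (n D : ℕ) : Prop where
  isTree : T.IsTree
  ncard_edgeSet : T.edgeSet.ncard = n
  ncard_neighborSet_le : ∀ v, (T.neighborSet v).ncard ≤ D

/-- `G → (H, 𝒯(n, D))`: `G → (H, T)` for every tree `T` with `n` edges and maximum degree at
most `D`. Every finite tree is isomorphic to one whose vertex set lives in `Type`. -/
def RamseyArrowTrees {V W₁ : Type*} (G : SimpleGraph V) (H : SimpleGraph W₁) (n D : ℕ) : Prop :=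
  ∀ (W : Type) [Finite W] (T : SimpleGraph W), IsBoundedDegreeTree T n D → RamseyArrow G H T

open Finset

/-! Fix a colouring with no red copy of the tree. A set `U` of about `(r + ε)n` vertices then
contains `r + 1` disjoint sets of size `m = ⌈δn⌉` with no red edge between them. If the random graph
has a clique crossing every such family, that clique is blue.

Tree side (`SimpleGraph.IsTree.exists_disjoint_not_adj`): if every `m`-subset of `U` has a closed
red neighbourhood larger than `n` by a suitable multiple of `m`, then deleting a maximal
non-expanding set leaves an expander, and Haxell's theorem embeds the tree. Otherwise some `m`-set
has a small closed neighbourhood. Set it aside, discard that neighbourhood and repeat `r` times, at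
a total cost of about `rn + O(m)` vertices.

Random side (`SimpleGraph.binomialRandom_no_crossing_clique_le`): for `p ≥ C n^(-2/(r+1))` the
expected number of crossing `k`-cliques is at least `A n` for every `2 ≤ k ≤ r + 1`, so Janson's
inequality bounds the failure probability of one family by `exp(-A n / 2^(r+3))`. There are at most
`2^((r+1)|U|)` families, and a large `A` beats this union bound. -/

/-- The expectation of `f ω` where `ω` is the random subset of `E` containing each element
independently with probability `p`. -/
noncomputable def bernoulliExpect {α : Type*} [DecidableEq α] (E : Finset α) (p : ℝ)
    (f : Finset α → ℝ) : ℝ :=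
  ∑ ω ∈ E.powerset, p ^ #ω * (1 - p) ^ #(E \ ω) * f ω

/-! ### Product Bernoulli measure: Harris and Janson inequalities -/

section BernoulliExpect

variable {α : Type*} [DecidableEq α] {E : Finset α} {p : ℝ}

/-- Conditioning on one coordinate; this drives the inductions on `E` and the one-coordinate Harris
inequality. -/
lemma bernoulliExpect_insert {e : α} (he : e ∉ E) (f : Finset α → ℝ) :
    bernoulliExpect (insert e E) p f =
      p * bernoulliExpect E p (fun ω => f (insert e ω)) + (1 - p) * bernoulliExpect E p f := by
  unfold bernoulliExpect
  rw [sum_powerset_insert he, mul_sum, mul_sum, add_comm]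
  congr 1
  · refine sum_congr rfl fun ω hω => ?_
    have h1 : e ∉ ω := fun h => he (mem_powerset.1 hω h)
    have h2 : insert e E \ insert e ω = E \ ω := by grind
    rw [h2, card_insert_of_notMem h1]
    ring
  · refine sum_congr rfl fun ω hω => ?_
    have h2 : insert e E \ ω = insert e (E \ ω) := by
      have h1 : e ∉ ω := fun h => he (mem_powerset.1 hω h)
      grind
    rw [h2, card_insert_of_notMem (by grind)]
    ring

lemma bernoulliExpect_mono (hp0 : 0 ≤ p) (hp1 : p ≤ 1) {f g : Finset α → ℝ}
    (h : ∀ ω, f ω ≤ g ω) : bernoulliExpect E p f ≤ bernoulliExpect E p g := by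
  refine sum_le_sum fun ω _ => mul_le_mul_of_nonneg_left (h ω) ?_
  have : 0 ≤ 1 - p := by linarith
  positivity

lemma bernoulliExpect_const (c : ℝ) : bernoulliExpect E p (fun _ => c) = c := by
  induction E using Finset.induction_on with
  | empty => simp [bernoulliExpect]
  | insert e E he ih => rw [bernoulliExpect_insert he, ih]; ring

lemma bernoulliExpect_sub (f g : Finset α → ℝ) :
    bernoulliExpect E p (fun ω => f ω - g ω) = bernoulliExpect E p f - bernoulliExpect E p g := by
  simp only [bernoulliExpect, mul_sub, sum_sub_distrib]

lemma bernoulliExpect_const_mul (c : ℝ) (f : Finset α → ℝ) :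
    bernoulliExpect E p (fun ω => c * f ω) = c * bernoulliExpect E p f := by
  simp only [bernoulliExpect, mul_sum]
  exact sum_congr rfl fun _ _ => by ring

lemma bernoulliExpect_sum {ι : Type*} (I : Finset ι) (f : ι → Finset α → ℝ) :
    bernoulliExpect E p (fun ω => ∑ i ∈ I, f i ω) = ∑ i ∈ I, bernoulliExpect E p (f i) := by
  simp only [bernoulliExpect, mul_sum]
  exact sum_comm

lemma bernoulliExpect_nonneg (hp0 : 0 ≤ p) (hp1 : p ≤ 1) {f : Finset α → ℝ} (h : ∀ ω, 0 ≤ f ω) :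
    0 ≤ bernoulliExpect E p f := by
  rw [← bernoulliExpect_const (E := E) (p := p) 0]
  exact bernoulliExpect_mono hp0 hp1 h

/-- Harris for a single coordinate: condition on `e`; the average of `f` with `e` present is at most
its average with `e` absent. -/
lemma bernoulliExpect_mul_mem_le (hp0 : 0 ≤ p) (hp1 : p ≤ 1) {e : α} (he : e ∈ E)
    {f : Finset α → ℝ} (hf : ∀ ω, f (insert e ω) ≤ f ω) :
    bernoulliExpect E p (fun ω => f ω * if e ∈ ω then 1 else 0) ≤ p * bernoulliExpect E p f := by
  rw [← insert_erase he, bernoulliExpect_insert (notMem_erase e E),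
    bernoulliExpect_insert (notMem_erase e E)]
  have h0 : bernoulliExpect (E.erase e) p (fun ω => f ω * if e ∈ ω then 1 else 0) = 0 := by
    refine sum_eq_zero fun ω hω => ?_
    have : e ∉ ω := fun h => notMem_erase e E (mem_powerset.1 hω h)
    simp [this]
  have h1 := bernoulliExpect_mono (E := E.erase e) hp0 hp1 hf
  simp only [mem_insert_self, if_true, mul_one, h0]
  nlinarith [mul_nonneg hp0 (sub_nonneg.2 hp1)]

/-- Harris' inequality for a function decreasing in the coordinates of `A` and the event
`A ⊆ ω`. -/
lemma bernoulliExpect_mul_subset_le (hp0 : 0 ≤ p) (hp1 : p ≤ 1) {A : Finset α} (hA : A ⊆ E)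
    {f : Finset α → ℝ} (hf : ∀ e ∈ A, ∀ ω, f (insert e ω) ≤ f ω) :
    bernoulliExpect E p (fun ω => f ω * if A ⊆ ω then 1 else 0) ≤
      p ^ #A * bernoulliExpect E p f := by
  induction A using Finset.induction_on with
  | empty => simp
  | insert e A he ih =>
    have h1 := ih (fun x hx => hA (mem_insert_of_mem hx))
      (fun x hx => hf x (mem_insert_of_mem hx))
    have h2 := bernoulliExpect_mul_mem_le hp0 hp1 (hA (mem_insert_self e A))
      (f := fun ω => f ω * if A ⊆ ω then 1 else 0) (fun ω => by
        simp only [subset_insert_iff_of_notMem he]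
        exact mul_le_mul_of_nonneg_right (hf e (mem_insert_self e A) ω) (by split_ifs <;> simp))
    rw [card_insert_of_notMem he, pow_succ']
    calc _ = _ := by
          congr 1; ext ω
          by_cases h : e ∈ ω <;> simp [insert_subset_iff, h]
      _ ≤ _ := h2
      _ ≤ _ := by rw [mul_assoc]; exact mul_le_mul_of_nonneg_left h1 hp0

/-- This is the half of independence that Janson needs: `f` ignores the coordinates in `A`, so
Harris also applies to `-f`. -/
lemma le_bernoulliExpect_mul_subset (hp0 : 0 ≤ p) (hp1 : p ≤ 1) {A : Finset α} (hA : A ⊆ E)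
    {f : Finset α → ℝ} (hf : ∀ e ∈ A, ∀ ω, f (insert e ω) = f ω) :
    p ^ #A * bernoulliExpect E p f ≤
      bernoulliExpect E p (fun ω => f ω * if A ⊆ ω then 1 else 0) := by
  have h := bernoulliExpect_mul_subset_le hp0 hp1 hA (f := fun ω => -1 * f ω)
    (fun e he ω => by rw [hf e he])
  simp only [mul_assoc, bernoulliExpect_const_mul] at h
  linarith

lemma one_sub_sum_le_prod_one_sub {ι : Type*} (s : Finset ι) (x : ι → ℝ) (h0 : ∀ i ∈ s, 0 ≤ x i)
    (h1 : ∀ i ∈ s, x i ≤ 1) : 1 - ∑ i ∈ s, x i ≤ ∏ i ∈ s, (1 - x i) := by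
  classical
  induction s using Finset.induction_on with
  | empty => simp
  | insert i s hi ih =>
    have h2 := ih (fun j hj => h0 j (mem_insert_of_mem hj)) fun j hj => h1 j (mem_insert_of_mem hj)
    have h3 : 0 ≤ ∑ j ∈ s, x j := sum_nonneg fun j hj => h0 j (mem_insert_of_mem hj)
    rw [sum_insert hi, prod_insert hi]
    nlinarith [h0 i (mem_insert_self i s), h1 i (mem_insert_self i s)]

/-- A form of Janson's inequality: the product `∏ (1 - q 1_{A i ⊆ ω})` dominates the indicator of
the event that no `A i` is contained in `ω`. -/
theorem bernoulliExpect_prod_le_exp {ι : Type*} [DecidableEq ι] (hp0 : 0 ≤ p) (hp1 : p ≤ 1)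
    {q : ℝ} (hq0 : 0 ≤ q) (hq1 : q ≤ 1) (A : ι → Finset α) (hA : ∀ i, A i ⊆ E) (I : Finset ι) :
    bernoulliExpect E p (fun ω => ∏ i ∈ I, (1 - q * if A i ⊆ ω then 1 else 0)) ≤
      Real.exp (-(q * ∑ i ∈ I, p ^ #(A i)) +
        q ^ 2 * ∑ i ∈ I, ∑ j ∈ I with ¬ Disjoint (A i) (A j), p ^ #(A i ∪ A j)) := by
  have fac0 : ∀ i ω, 0 ≤ 1 - q * (if A i ⊆ ω then 1 else 0 : ℝ) := by
    intro i ω; split_ifs <;> linarith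
  have fac1 : ∀ i ω, 1 - q * (if A i ⊆ ω then 1 else 0 : ℝ) ≤ 1 := by
    intro i ω; split_ifs <;> linarith
  have facanti : ∀ i e ω, 1 - q * (if A i ⊆ insert e ω then 1 else 0 : ℝ) ≤
      1 - q * (if A i ⊆ ω then 1 else 0 : ℝ) := by
    intro i e ω
    by_cases h : A i ⊆ ω
    · simp [h, h.trans (subset_insert e ω)]
    · simp only [h, if_false]; split_ifs <;> linarith
  induction I using Finset.induction_on with
  | empty => simp [bernoulliExpect_const]
  | insert i I hi ih =>
    set F : Finset ι → Finset α → ℝ := fun K ω => ∏ j ∈ K, (1 - q * if A j ⊆ ω then 1 else 0)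
      with hF
    have F0 : ∀ K ω, 0 ≤ F K ω := fun K ω => prod_nonneg fun j _ => fac0 j ω
    have F1 : ∀ K ω, F K ω ≤ 1 := fun K ω => prod_le_one (fun j _ => fac0 j ω) fun j _ => fac1 j ω
    have Fanti : ∀ K e ω, F K (insert e ω) ≤ F K ω := fun K e ω =>
      prod_le_prod (fun j _ => fac0 j _) fun j _ => facanti j e ω
    -- Split off the factors dependent on `A i`. `F Z` is independent of `A i ⊆ ω`, while `F Y` is
    -- bounded below linearly, with Harris controlling each resulting correction term.
    set Y := I.filter fun j => ¬ Disjoint (A i) (A j) with hY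
    set Z := I.filter fun j => Disjoint (A i) (A j) with hZ
    have hsplit : ∀ ω, F I ω = F Z ω * F Y ω := fun ω =>
      (prod_filter_mul_prod_filter_not I _ _).symm
    have hYlow : ∀ ω, 1 - q * ∑ j ∈ Y, (if A j ⊆ ω then 1 else 0 : ℝ) ≤ F Y ω := by
      intro ω
      rw [mul_sum]
      refine one_sub_sum_le_prod_one_sub Y _ ?_ ?_ <;> intro j _ <;> split_ifs <;> simp [hq0, hq1]
    set EF := bernoulliExpect E p (F I)
    set EZ := bernoulliExpect E p (F Z)
    have hEFZ : EF ≤ EZ := bernoulliExpect_mono hp0 hp1 fun ω => by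
      rw [hsplit]; exact mul_le_of_le_one_right (F0 _ _) (F1 _ _)
    have hEF0 : 0 ≤ EF := bernoulliExpect_nonneg hp0 hp1 (F0 I)
    set δ := ∑ j ∈ Y, p ^ #(A i ∪ A j) with hδ
    set X := bernoulliExpect E p (fun ω => F I ω * if A i ⊆ ω then 1 else 0) with hX
    have hX0 : 0 ≤ X := bernoulliExpect_nonneg hp0 hp1 fun ω =>
      mul_nonneg (F0 _ _) (by split_ifs <;> simp)
    have hXZ : EZ * (p ^ #(A i) - q * δ) ≤ X := by
      have h1 : p ^ #(A i) * EZ ≤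
          bernoulliExpect E p (fun ω => F Z ω * if A i ⊆ ω then 1 else 0) := by
        refine le_bernoulliExpect_mul_subset hp0 hp1 (hA i) fun e he ω => ?_
        refine prod_congr rfl fun j hj => ?_
        have : e ∉ A j := disjoint_left.1 (mem_filter.1 hj).2 he
        simp only [subset_insert_iff_of_notMem this]
      have h2 : ∀ j ∈ Y, bernoulliExpect E p (fun ω => F Z ω * if A i ∪ A j ⊆ ω then 1 else 0) ≤
          p ^ #(A i ∪ A j) * EZ := fun j _ =>
        bernoulliExpect_mul_subset_le hp0 hp1 (union_subset (hA i) (hA j)) fun e _ ω => Fanti _ e ω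
      have h3 : bernoulliExpect E p (fun ω => (F Z ω * if A i ⊆ ω then 1 else 0) -
          q * ∑ j ∈ Y, (F Z ω * if A i ∪ A j ⊆ ω then 1 else 0)) ≤ X := by
        refine bernoulliExpect_mono hp0 hp1 fun ω => ?_
        rw [hsplit]
        have h4 := mul_le_mul_of_nonneg_left (hYlow ω) (F0 Z ω)
        by_cases h : A i ⊆ ω
        · simp only [union_subset_iff, h, true_and, if_true, mul_one, ← mul_sum]
          linarith
        · simp [union_subset_iff, h]
      rw [bernoulliExpect_sub, bernoulliExpect_const_mul, bernoulliExpect_sum] at h3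
      have h5 := mul_le_mul_of_nonneg_left (sum_le_sum h2) hq0
      rw [← sum_mul, ← hδ] at h5
      linarith
    have hXF : EF * (p ^ #(A i) - q * δ) ≤ X := by
      -- Replacing `EZ` by the smaller `EF` is legitimate only when the bracket is nonnegative;
      -- otherwise `X ≥ 0` suffices.
      rcases le_total 0 (p ^ #(A i) - q * δ) with h | h
      · exact (mul_le_mul_of_nonneg_right hEFZ h).trans hXZ
      · exact (mul_nonpos_of_nonneg_of_nonpos hEF0 h).trans hX0
    have hstep : bernoulliExpect E p (F (insert i I)) = EF - q * X := by
      rw [hX, ← bernoulliExpect_const_mul, ← bernoulliExpect_sub]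
      congr 1; ext ω
      simp only [hF, prod_insert hi]
      ring
    calc _ = EF - q * X := hstep
      _ ≤ EF * (-(q * (p ^ #(A i) - q * δ)) + 1) := by
        nlinarith [mul_le_mul_of_nonneg_left hXF hq0]
      _ ≤ EF * Real.exp (-(q * (p ^ #(A i) - q * δ))) :=
        mul_le_mul_of_nonneg_left (Real.add_one_le_exp _) hEF0
      _ ≤ _ := mul_le_mul_of_nonneg_right ih (Real.exp_pos _).le
      _ ≤ _ := by
        rw [← Real.exp_add]
        refine Real.exp_le_exp.2 ?_
        have hδ' : δ + ∑ k ∈ I, ∑ j ∈ I with ¬ Disjoint (A k) (A j), p ^ #(A k ∪ A j) ≤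
            ∑ k ∈ insert i I, ∑ j ∈ insert i I with ¬ Disjoint (A k) (A j), p ^ #(A k ∪ A j) := by
          rw [sum_insert hi]
          refine add_le_add ?_ (sum_le_sum fun k _ => ?_) <;>
          exact sum_le_sum_of_subset_of_nonneg (filter_subset_filter _ (subset_insert i I))
            fun _ _ _ => pow_nonneg hp0 _
        rw [sum_insert hi]
        nlinarith [mul_le_mul_of_nonneg_left hδ' (sq_nonneg q)]

end BernoulliExpect

/-! ### Crossing cliques between disjoint vertex sets -/

section CrossingCliques

variable {V : Type*} {s m : ℕ} {S : Fin s → Finset V}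

lemma injective_of_mem_piFinset (hdisj : Pairwise fun i j => Disjoint (S i) (S j))
    {φ : Fin s → V} (hφ : φ ∈ Fintype.piFinset S) : Function.Injective φ := by
  intro i j hij
  by_contra h
  rw [Fintype.mem_piFinset] at hφ
  exact disjoint_left.1 (hdisj h) (hφ i) (hij ▸ hφ j)

variable [DecidableEq V]

/-- The edges of the complete graph on `K`. -/
def completeEdges (K : Finset V) : Finset (Sym2 V) :=
  K.offDiag.image Sym2.mk.uncurry

lemma card_completeEdges (K : Finset V) : #(completeEdges K) = (#K).choose 2 :=
  Sym2.card_image_offDiag K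

lemma mem_completeEdges {K : Finset V} {x y : V} :
    s(x, y) ∈ completeEdges K ↔ x ∈ K ∧ y ∈ K ∧ x ≠ y := by
  simp only [completeEdges, mem_image, mem_offDiag, Prod.exists, Function.uncurry_apply_pair,
    Sym2.eq_iff]
  constructor
  · rintro ⟨a, b, ⟨ha, hb, hab⟩, ⟨rfl, rfl⟩ | ⟨rfl, rfl⟩⟩
    · exact ⟨ha, hb, hab⟩
    · exact ⟨hb, ha, hab.symm⟩
  · rintro ⟨hx, hy, hxy⟩
    exact ⟨x, y, ⟨hx, hy, hxy⟩, Or.inl ⟨rfl, rfl⟩⟩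

lemma completeEdges_inter (K L : Finset V) :
    completeEdges K ∩ completeEdges L = completeEdges (K ∩ L) := by
  ext e
  induction e with
  | h x y =>
    simp only [mem_inter, mem_completeEdges]
    tauto

/-- The parts are disjoint, so a vertex common to two transversals has the same index in both. -/
lemma card_image_inter_image_le (hdisj : Pairwise fun i j => Disjoint (S i) (S j))
    {φ ψ : Fin s → V} (hφ : φ ∈ Fintype.piFinset S) (hψ : ψ ∈ Fintype.piFinset S) :
    #(univ.image φ ∩ univ.image ψ) ≤ #{i | φ i = ψ i} := by
  refine (card_le_card (t := ({i | φ i = ψ i} : Finset (Fin s)).image φ) ?_).trans card_image_le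
  intro x hx
  simp only [mem_inter, mem_image, mem_univ, true_and] at hx
  obtain ⟨⟨i, rfl⟩, j, hj⟩ := hx
  rw [Fintype.mem_piFinset] at hφ hψ
  have hij : i = j := by
    by_contra h
    exact disjoint_left.1 (hdisj h) (hφ i) (hj ▸ hψ j)
  subst hij
  exact mem_image.2 ⟨i, by simp [hj], rfl⟩

/-- The pairs of a fixed crossing clique with the crossing cliques sharing an edge with it. -/
lemma sum_pow_card_union_le (hdisj : Pairwise fun i j => Disjoint (S i) (S j))
    (hcard : ∀ i, #(S i) = m) {p L : ℝ} (hp0 : 0 < p) (hp1 : p ≤ 1) (hL : 0 < L) (hm : 0 < m)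
    (hLk : ∀ k, 2 ≤ k → k ≤ s → L ≤ (m : ℝ) ^ k * p ^ k.choose 2)
    {φ : Fin s → V} (hφ : φ ∈ Fintype.piFinset S) :
    ∑ ψ ∈ Fintype.piFinset S with
        ¬ Disjoint (completeEdges (univ.image φ)) (completeEdges (univ.image ψ)),
      p ^ #(completeEdges (univ.image φ) ∪ completeEdges (univ.image ψ)) ≤
      2 ^ s * ((m : ℝ) ^ s * p ^ (2 * s.choose 2) / L) := by
  classical
  have hcd : ∀ {χ}, χ ∈ Fintype.piFinset S → #(completeEdges (univ.image χ)) = s.choose 2 := by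
    intro χ hχ
    rw [card_completeEdges, card_image_of_injective _ (injective_of_mem_piFinset hdisj hχ),
      card_univ, Fintype.card_fin]
  -- Group the `ψ` by the set `J` of indices where they agree with `φ`. A shared edge forces `#J ≥
  -- 2`, at most `m ^ (s - #J)` choices of `ψ` remain, and `hLk` for `k = #J` bounds the fibre;
  -- there are `2 ^ s` sets `J`.
  let agree : (Fin s → V) → Finset (Fin s) := fun ψ => {i | φ i = ψ i}
  set Ψ := {ψ ∈ Fintype.piFinset S |
    ¬ Disjoint (completeEdges (univ.image φ)) (completeEdges (univ.image ψ))} with hΨ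
  have hinter : ∀ ψ ∈ Fintype.piFinset S,
      #(completeEdges (univ.image φ) ∩ completeEdges (univ.image ψ)) ≤ (#(agree ψ)).choose 2 := by
    intro ψ hψ
    rw [completeEdges_inter, card_completeEdges]
    exact Nat.choose_le_choose 2 (card_image_inter_image_le hdisj hφ hψ)
  rw [← sum_fiberwise_of_maps_to (s := Ψ) (t := univ) (g := agree) (fun _ _ => mem_univ _)]
  have hfib : ∀ J : Finset (Fin s), ∑ ψ ∈ Ψ with agree ψ = J,
      p ^ #(completeEdges (univ.image φ) ∪ completeEdges (univ.image ψ)) ≤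
      (m : ℝ) ^ s * p ^ (2 * s.choose 2) / L := by
    intro J
    by_cases hJ : 2 ≤ #J
    swap
    · refine (sum_nonpos fun ψ hψ => ?_).trans (by positivity)
      exfalso
      simp only [hΨ, mem_filter] at hψ
      have h1 := hinter ψ hψ.1.1
      rw [hψ.2, Nat.choose_eq_zero_of_lt (by omega)] at h1
      exact hψ.1.2 (disjoint_iff_inter_eq_empty.2 (card_eq_zero.1 (by omega)))
    have hJs : #J ≤ s := by simpa using card_le_univ J
    have hc : 0 < p ^ (#J).choose 2 := by positivity
    have hterm : ∀ ψ ∈ Ψ.filter (agree · = J),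
        p ^ #(completeEdges (univ.image φ) ∪ completeEdges (univ.image ψ)) ≤
          p ^ (2 * s.choose 2) / p ^ (#J).choose 2 := by
      intro ψ hψ
      simp only [hΨ, mem_filter] at hψ
      rw [le_div_iff₀ hc, ← pow_add]
      refine pow_le_pow_of_le_one hp0.le hp1 ?_
      have h1 := hinter ψ hψ.1.1
      have h2 := card_union_add_card_inter (completeEdges (univ.image φ))
        (completeEdges (univ.image ψ))
      rw [hcd hφ, hcd hψ.1.1] at h2
      rw [hψ.2] at h1
      omega
    have hnum : #(Ψ.filter (agree · = J)) ≤ m ^ (s - #J) := by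
      calc _ ≤ #(Fintype.piFinset fun i => if i ∈ J then {φ i} else S i) := by
            refine card_le_card fun ψ hψ => ?_
            simp only [hΨ, mem_filter, Fintype.mem_piFinset] at hψ ⊢
            intro i
            split_ifs with hi
            · rw [← hψ.2] at hi
              simp only [agree, mem_filter, mem_univ, true_and] at hi
              simp [hi]
            · exact hψ.1.1 i
        _ = ∏ i, if i ∈ J then 1 else m := by
            rw [Fintype.card_piFinset]
            refine prod_congr rfl fun i _ => ?_
            split_ifs <;> simp [hcard]
        _ = _ := by
            rw [prod_ite, prod_const_one, one_mul, prod_const, filter_not, filter_mem_eq_inter,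
              univ_inter, card_sdiff_of_subset (subset_univ J), card_univ, Fintype.card_fin]
    calc _ ≤ #(Ψ.filter (agree · = J)) • (p ^ (2 * s.choose 2) / p ^ (#J).choose 2) :=
          sum_le_card_nsmul _ _ _ hterm
      _ ≤ (m : ℝ) ^ (s - #J) * (p ^ (2 * s.choose 2) / p ^ (#J).choose 2) := by
          rw [nsmul_eq_mul]
          refine mul_le_mul_of_nonneg_right ?_ (by positivity)
          exact_mod_cast hnum
      _ = (m : ℝ) ^ s * p ^ (2 * s.choose 2) / ((m : ℝ) ^ #J * p ^ (#J).choose 2) := by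
          have hm' : (m : ℝ) ≠ 0 := by positivity
          have hpow : (m : ℝ) ^ s = (m : ℝ) ^ (s - #J) * (m : ℝ) ^ #J := by
            rw [← pow_add, Nat.sub_add_cancel hJs]
          rw [hpow]
          field_simp
      _ ≤ _ := div_le_div_of_nonneg_left (by positivity) hL (hLk _ hJ hJs)
  calc _ ≤ #(univ : Finset (Finset (Fin s))) • ((m : ℝ) ^ s * p ^ (2 * s.choose 2) / L) :=
        sum_le_card_nsmul _ _ _ fun J _ => hfib J
    _ = _ := by simp

/-- If the expected numbers of cliques of all sizes between disjoint `m`-sets are at least `L`, then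
a random graph has no crossing clique with probability at most `exp (- L / 2 ^ (s + 2))`. -/
theorem exists_bernoulliExpect_crossing_le (hdisj : Pairwise fun i j => Disjoint (S i) (S j))
    (hcard : ∀ i, #(S i) = m) {p L : ℝ} (hp0 : 0 < p) (hp1 : p ≤ 1) (hL : 0 < L) (hm : 0 < m)
    (hs : 2 ≤ s) (hLk : ∀ k, 2 ≤ k → k ≤ s → L ≤ (m : ℝ) ^ k * p ^ k.choose 2)
    {E : Finset (Sym2 V)} (hE : ∀ e, ¬ e.IsDiag → e ∈ E) :
    ∃ F : Finset (Sym2 V) → ℝ, (∀ ω, 0 ≤ F ω) ∧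
      (∀ ω, (∀ φ ∈ Fintype.piFinset S, ¬ completeEdges (univ.image φ) ⊆ ω) → F ω = 1) ∧
      bernoulliExpect E p F ≤ Real.exp (-(L / 2 ^ (s + 2))) := by
  set μ : ℝ := (m : ℝ) ^ s * p ^ s.choose 2 with hμ
  have hμL : L ≤ μ := hLk s hs le_rfl
  have hμ0 : 0 < μ := hL.trans_le hμL
  -- With the pair sum at most `2 ^ s * μ ^ 2 / L`, this `q` minimises the bound `-qμ + q² 2^s μ² /
  -- L`, whose value becomes `-L / 2 ^ (s + 2)`. The case `k = s` of `hLk` ensures `q ≤ 1`.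
  set q : ℝ := L / (2 ^ (s + 1) * μ) with hq
  have hq0 : 0 ≤ q := by positivity
  have hq1 : q ≤ 1 := by
    rw [hq, div_le_one (by positivity)]
    have : (1 : ℝ) ≤ 2 ^ (s + 1) := one_le_pow₀ (by norm_num)
    nlinarith
  refine ⟨fun ω => ∏ φ ∈ Fintype.piFinset S,
    (1 - q * if completeEdges (univ.image φ) ⊆ ω then 1 else 0), ?_, ?_, ?_⟩
  · intro ω
    refine prod_nonneg fun φ _ => ?_
    split_ifs <;> linarith
  · intro ω h
    refine prod_eq_one fun φ hφ => ?_
    simp [h φ hφ]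
  · refine (bernoulliExpect_prod_le_exp hp0.le hp1 hq0 hq1
      (fun φ : Fin s → V => completeEdges (univ.image φ)) ?_ _).trans (Real.exp_le_exp.2 ?_)
    · intro φ e
      induction e with
      | h x y =>
        intro he
        refine hE _ ?_
        simpa using (mem_completeEdges.1 he).2.2
    · have hΦ : (#(Fintype.piFinset S) : ℝ) = (m : ℝ) ^ s := by
        simp [Fintype.card_piFinset, hcard]
      have h1 : ∑ φ ∈ Fintype.piFinset S, p ^ #(completeEdges (univ.image φ)) = μ := by
        rw [sum_congr rfl (g := fun _ => p ^ s.choose 2), sum_const, nsmul_eq_mul, hΦ]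
        intro φ hφ
        rw [card_completeEdges, card_image_of_injective _ (injective_of_mem_piFinset hdisj hφ),
          card_univ, Fintype.card_fin]
      have h2 := sum_le_card_nsmul (Fintype.piFinset S) _ _ fun φ hφ =>
        sum_pow_card_union_le hdisj hcard hp0 hp1 hL hm hLk hφ
      rw [nsmul_eq_mul, hΦ] at h2
      rw [h1]
      have h3 : (m : ℝ) ^ s * (2 ^ s * ((m : ℝ) ^ s * p ^ (2 * s.choose 2) / L)) =
          2 ^ s * μ ^ 2 / L := by
        rw [hμ, two_mul, pow_add]; ring
      rw [h3] at h2
      calc _ ≤ -(q * μ) + q ^ 2 * (2 ^ s * μ ^ 2 / L) := by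
            gcongr
        _ = -(L / 2 ^ (s + 2)) := by
            rw [hq, pow_add, pow_add]
            field_simp
            ring

end CrossingCliques

/-! ### Transfer to the binomial random graph -/

section RandomGraph

open MeasureTheory

variable {V : Type*} [Fintype V] [DecidableEq V]

/-- Markov's inequality for the binomial random graph. -/
lemma SimpleGraph.binomialRandom_le_bernoulliExpect (p : unitInterval) (𝒮 : Set (SimpleGraph V))
    {F : Finset (Sym2 V) → ℝ} (hF0 : ∀ ω, 0 ≤ F ω)
    (hF1 : ∀ G ∈ 𝒮, ∀ ω : Finset (Sym2 V), (ω : Set (Sym2 V)) = G.edgeSet → 1 ≤ F ω) :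
    SimpleGraph.binomialRandom V p 𝒮 ≤
      ENNReal.ofReal (bernoulliExpect {e : Sym2 V | ¬ e.IsDiag} p F) := by
  classical
  set E : Finset (Sym2 V) := {e : Sym2 V | ¬ e.IsDiag} with hE
  have hEcard : #E = (Fintype.card V).choose 2 := by
    rw [← Sym2.card_subtype_not_diag, Fintype.card_subtype]
  have hp0 := p.2.1
  have hp1 : 0 ≤ 1 - (p : ℝ) := sub_nonneg.2 p.2.2
  let w : Finset (Sym2 V) → ℝ := fun ω => (p : ℝ) ^ #ω * (1 - p) ^ #(E \ ω)
  have hw : ∀ ω, 0 ≤ w ω := fun ω => by positivity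
  have hsub : ∀ G : SimpleGraph V, G.edgeFinset ⊆ E := fun G e he => by
    simp only [hE, mem_filter, mem_univ, true_and]
    exact G.not_isDiag_of_mem_edgeFinset he
  have hsingle : ∀ G : SimpleGraph V,
      SimpleGraph.binomialRandom V p {G} = ENNReal.ofReal (w G.edgeFinset) := by
    intro G
    rw [SimpleGraph.binomialRandom_singleton]
    simp only [w]
    rw [ENNReal.ofReal_mul (by positivity), ENNReal.ofReal_pow hp0, ENNReal.ofReal_pow hp1,
      card_sdiff_of_subset (hsub G), hEcard, ← Set.ncard_coe_finset, coe_edgeFinset,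
      Nat.card_eq_fintype_card, ENNReal.ofReal_eq_coe_nnreal hp0, ENNReal.ofReal_eq_coe_nnreal hp1]
    rfl
  have hfin : 𝒮 = ⋃ G ∈ 𝒮.toFinset, {G} := by ext; simp
  calc _ ≤ ∑ G ∈ 𝒮.toFinset, SimpleGraph.binomialRandom V p {G} := by
        conv_lhs => rw [hfin]
        exact measure_biUnion_finset_le _ _
    _ = ENNReal.ofReal (∑ G ∈ 𝒮.toFinset, w G.edgeFinset) := by
        rw [ENNReal.ofReal_sum_of_nonneg fun _ _ => hw _]
        exact sum_congr rfl fun G _ => hsingle G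
    _ ≤ _ := by
        refine ENNReal.ofReal_le_ofReal ?_
        calc _ ≤ ∑ G ∈ 𝒮.toFinset, w G.edgeFinset * F G.edgeFinset := by
              refine sum_le_sum fun G hG => le_mul_of_one_le_right (hw _) ?_
              exact hF1 G (Set.mem_toFinset.1 hG) _ (coe_edgeFinset G)
          -- A graph is determined by its edge set, so the sum over graphs becomes part of the sum
          -- over `E.powerset`.
          _ = ∑ ω ∈ 𝒮.toFinset.image fun G => G.edgeFinset, w ω * F ω := by
              rw [sum_image fun G _ H _ h => edgeFinset_inj.1 h]
          _ ≤ _ := by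
              refine sum_le_sum_of_subset_of_nonneg (fun ω hω => ?_)
                fun ω _ _ => mul_nonneg (hw ω) (hF0 ω)
              obtain ⟨G, -, rfl⟩ := mem_image.1 hω
              exact mem_powerset.2 (hsub G)

theorem SimpleGraph.binomialRandom_no_crossing_clique_le {s m : ℕ} {S : Fin s → Finset V}
    (hdisj : Pairwise fun i j => Disjoint (S i) (S j)) (hcard : ∀ i, #(S i) = m)
    {p : unitInterval} {L : ℝ} (hp0 : 0 < (p : ℝ)) (hL : 0 < L) (hm : 0 < m) (hs : 2 ≤ s)
    (hLk : ∀ k, 2 ≤ k → k ≤ s → L ≤ (m : ℝ) ^ k * (p : ℝ) ^ k.choose 2) :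
    SimpleGraph.binomialRandom V p
      {G | ¬ ∃ φ : Fin s → V, (∀ i, φ i ∈ S i) ∧ ∀ i j, i ≠ j → G.Adj (φ i) (φ j)} ≤
      ENNReal.ofReal (Real.exp (-(L / 2 ^ (s + 2)))) := by
  obtain ⟨F, hF0, hF1, hF⟩ := exists_bernoulliExpect_crossing_le hdisj hcard hp0 p.2.2 hL hm hs hLk
    (E := {e : Sym2 V | ¬ e.IsDiag}) (by simp)
  refine (SimpleGraph.binomialRandom_le_bernoulliExpect p _ hF0 fun G hG ω hω => ?_).trans
    (ENNReal.ofReal_le_ofReal hF)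
  refine (hF1 ω fun φ hφ hsub => hG ⟨φ, Fintype.mem_piFinset.1 hφ, fun i j hij => ?_⟩).ge
  rw [← SimpleGraph.mem_edgeSet, ← hω]
  refine hsub (mem_completeEdges.2 ⟨by simp, by simp, ?_⟩)
  exact fun h => hij (injective_of_mem_piFinset hdisj hφ h)

end RandomGraph

/-! ### Embedding bounded degree trees in expanders -/

section TreeEmbedding

variable {V : Type*}

open Classical in
/-- The set of vertices of `U` with a `G`-neighbour in `X`. -/
noncomputable def SimpleGraph.nbhdIn (G : SimpleGraph V) (U X : Finset V) : Finset V :=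
  {y ∈ U | ∃ x ∈ X, G.Adj x y}

variable {G : SimpleGraph V} {U : Finset V}

lemma SimpleGraph.mem_nbhdIn {X : Finset V} {y : V} :
    y ∈ G.nbhdIn U X ↔ y ∈ U ∧ ∃ x ∈ X, G.Adj x y := by
  simp [SimpleGraph.nbhdIn]

lemma SimpleGraph.nbhdIn_mono {X Y : Finset V} (h : X ⊆ Y) : G.nbhdIn U X ⊆ G.nbhdIn U Y := by
  intro y hy
  rw [SimpleGraph.mem_nbhdIn] at hy ⊢
  obtain ⟨hy, x, hx, hxy⟩ := hy
  exact ⟨hy, x, h hx, hxy⟩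

variable [DecidableEq V]

lemma SimpleGraph.nbhdIn_union (X Y : Finset V) :
    G.nbhdIn U (X ∪ Y) = G.nbhdIn U X ∪ G.nbhdIn U Y := by
  ext y
  simp only [SimpleGraph.mem_nbhdIn, mem_union]
  grind

/-- One step of the Friedman–Pippenger–Haxell embedding: a partial embedding with image `P`, in
which `J x` is the number of used edges at `x`, extends by an edge at `v` keeping the expansion
invariant. -/
lemma exists_extension_vertex {d m n : ℕ} (hm : 1 ≤ m) {P : Finset V} {J : V → ℕ} {v : V}
    (hv : v ∈ U) (hJ : J v < d) (hP : #P ≤ n)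
    (hlarge : ∀ X ⊆ U, m < #X → #X ≤ 2 * m → d * #X + n + 1 ≤ #(G.nbhdIn U X))
    (hexp : ∀ X ⊆ U, #X ≤ 2 * m → d * #X ≤ #(G.nbhdIn U X \ P) + ∑ x ∈ X, J x) :
    ∃ y ∈ U, y ∉ P ∧ G.Adj v y ∧ ∀ X ⊆ U, #X ≤ 2 * m → d * #X ≤ #(G.nbhdIn U X \ insert y P) +
      ∑ x ∈ X, (J x + (if x = v then 1 else 0) + (if x = y then 1 else 0)) := by
  by_contra! hcon
  -- Critical sets are those for which the invariant is tight. By `hlarge` a tight set of size at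
  -- most `2 * m` has size at most `m`, so a union of two critical sets stays in range, and
  -- submodularity of the neighbourhood size makes it critical.
  let Crit : Finset V → Prop := fun X =>
    X ⊆ U ∧ #X ≤ m ∧ #(G.nbhdIn U X \ P) + ∑ x ∈ X, J x = d * #X
  have crit_of_eq : ∀ X ⊆ U, #X ≤ 2 * m → #(G.nbhdIn U X \ P) + ∑ x ∈ X, J x = d * #X →
      Crit X := by
    refine fun X hXU hX h => ⟨hXU, ?_, h⟩
    by_contra! hmX
    have h1 := hlarge X hXU hmX hX
    have h2 := le_card_sdiff P (G.nbhdIn U X)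
    omega
  have crit_union : ∀ X Y, Crit X → Crit Y → Crit (X ∪ Y) := by
    rintro X Y ⟨hXU, hX, hXe⟩ ⟨hYU, hY, hYe⟩
    have hU := union_subset hXU hYU
    have hc : #(X ∪ Y) ≤ 2 * m := (card_union_le X Y).trans (by omega)
    refine crit_of_eq _ hU hc ?_
    have h1 := hexp _ hU hc
    have h2 := hexp (X ∩ Y) (inter_subset_left.trans hXU)
      ((card_le_card inter_subset_left).trans (by omega))
    have h3 := sum_union_inter (s₁ := X) (s₂ := Y) (f := J)
    have h4 := card_union_add_card_inter (G.nbhdIn U X \ P) (G.nbhdIn U Y \ P)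
    have h5 : G.nbhdIn U (X ∪ Y) \ P = G.nbhdIn U X \ P ∪ G.nbhdIn U Y \ P := by
      rw [SimpleGraph.nbhdIn_union, union_sdiff_distrib]
    have h6 : #(G.nbhdIn U (X ∩ Y) \ P) ≤ #((G.nbhdIn U X \ P) ∩ (G.nbhdIn U Y \ P)) := by
      refine card_le_card (subset_inter ?_ ?_) <;> refine sdiff_subset_sdiff ?_ subset_rfl
      · exact SimpleGraph.nbhdIn_mono inter_subset_left
      · exact SimpleGraph.nbhdIn_mono inter_subset_right
    have h7 : d * #(X ∪ Y) + d * #(X ∩ Y) = d * #X + d * #Y := by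
      rw [← mul_add, ← mul_add, card_union_add_card_inter]
    rw [h5] at h1 ⊢
    omega
  -- Using `y` costs at most one neighbour, so a violated `X` was tight, sees `y`, and misses `v`,
  -- since otherwise the increment at `v` would compensate.
  have hbad : ∀ y, ∃ X, y ∈ G.nbhdIn U {v} \ P → Crit X ∧ y ∈ G.nbhdIn U X ∧ v ∉ X := by
    intro y
    by_cases hy : y ∈ G.nbhdIn U {v} \ P
    swap
    · exact ⟨∅, fun h => absurd h hy⟩
    have hy' := hy
    rw [mem_sdiff, SimpleGraph.mem_nbhdIn] at hy'
    obtain ⟨⟨hyU, x, hx, hxy⟩, hyP⟩ := hy'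
    rw [mem_singleton] at hx
    subst hx
    obtain ⟨X, hXU, hX, hlt⟩ := hcon y hyU hyP hxy
    have h1 := hexp X hXU hX
    simp only [sum_add_distrib, sum_ite_eq'] at hlt
    have h2 : G.nbhdIn U X \ insert y P = (G.nbhdIn U X \ P).erase y := by
      ext z; simp only [mem_sdiff, mem_insert, mem_erase]; tauto
    rw [h2] at hlt
    have h3 := pred_card_le_card_erase (s := G.nbhdIn U X \ P) (a := y)
    have h4 : y ∈ G.nbhdIn U X \ P := by
      by_contra h
      rw [erase_eq_of_notMem h] at hlt
      omega
    refine ⟨X, fun _ => ⟨crit_of_eq X hXU hX ?_, (mem_sdiff.1 h4).1, fun hvX => ?_⟩⟩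
    · omega
    · rw [if_pos hvX] at hlt
      omega
  choose X hX using hbad
  have hstar : ∀ Y ⊆ G.nbhdIn U {v} \ P, Crit (Y.biUnion X) := by
    intro Y
    induction Y using Finset.induction_on with
    | empty => exact fun _ => ⟨by simp, by simp, by simp [SimpleGraph.nbhdIn]⟩
    | insert y Y hy ih =>
      intro hYs
      rw [biUnion_insert]
      exact crit_union _ _ (hX y (hYs (mem_insert_self y Y))).1
        (ih ((subset_insert y Y).trans hYs))
  set Z := (G.nbhdIn U {v} \ P).biUnion X
  obtain ⟨hZU, hZ, hZe⟩ : Crit Z := hstar _ subset_rfl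
  have hvZ : v ∉ Z := by
    intro h
    obtain ⟨y, hy, hvy⟩ := mem_biUnion.1 h
    exact (hX y hy).2.2 hvy
  -- `Z` already sees every free neighbour of `v`, so adding `v` gains only `J v < d`, contradicting
  -- the invariant. The size bound `m + 1 ≤ 2 * m` uses `1 ≤ m`.
  have h1 := hexp (insert v Z) (insert_subset hv hZU) (by rw [card_insert_of_notMem hvZ]; omega)
  have h2 : G.nbhdIn U (insert v Z) \ P = G.nbhdIn U Z \ P := by
    rw [insert_eq, SimpleGraph.nbhdIn_union, union_sdiff_distrib, union_eq_right]
    intro y hy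
    exact mem_sdiff.2 ⟨SimpleGraph.nbhdIn_mono (subset_biUnion_of_mem X hy) (hX y hy).2.1,
      (mem_sdiff.1 hy).2⟩
  rw [h2, sum_insert hvZ, card_insert_of_notMem hvZ, mul_add, mul_one] at h1
  omega

/-- A vertex outside a connected vertex set of a forest has at most one neighbour in it. -/
lemma SimpleGraph.IsAcyclic.eq_of_adj_of_adj {W : Type*} {T : SimpleGraph W} (hT : T.IsAcyclic)
    {S : Set W} {a b w : W} (hw : w ∉ S) (p : T.Walk a b) (hp : ∀ x ∈ p.support, x ∈ S)
    (ha : T.Adj a w) (hb : T.Adj b w) : a = b := by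
  classical
  have hq : w ∉ p.bypass.support := fun h => hw (hp w (p.support_bypass_subset_support h))
  have h1 : (Walk.cons ha.symm p.bypass).IsPath :=
    (Walk.cons_isPath_iff _ _).2 ⟨p.bypass_isPath, hq⟩
  have h2 : (Walk.cons hb.symm Walk.nil).IsPath := by
    simp [Walk.cons_isPath_iff, hb.ne']
  have h3 := congrArg (fun q : T.Path w b => q.1.length)
    ((hT.subsingleton_path w b).elim ⟨_, h1⟩ ⟨_, h2⟩)
  simp only [Walk.length_cons, Walk.length_nil] at h3
  exact Walk.eq_of_length_eq_zero (p := p.bypass) (by omega)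

/-- Haxell's theorem: a graph in which small sets expand by a factor `d` and medium sets have large
neighbourhoods contains every tree with `n` edges and maximum degree at most `d`. -/
theorem SimpleGraph.IsTree.isContained_of_expansion {W : Type*} [Fintype W] {T : SimpleGraph W}
    (hT : T.IsTree) {d m n : ℕ} (hm : 1 ≤ m) (hcard : Fintype.card W ≤ n + 1)
    (hdeg : ∀ v, (T.neighborSet v).ncard ≤ d) (hU : U.Nonempty)
    (hsmall : ∀ X ⊆ U, X.Nonempty → #X ≤ m → d * #X + 1 ≤ #(G.nbhdIn U X))
    (hlarge : ∀ X ⊆ U, m < #X → #X ≤ 2 * m → d * #X + n + 1 ≤ #(G.nbhdIn U X)) :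
    T.IsContained G := by
  classical
  -- Grow the embedding one leaf at a time. The embedded part `S` stays connected, so that each new
  -- vertex has a unique neighbour in it, and `J` never exceeds the degree used so far.
  have key : ∀ k, 1 ≤ k → k ≤ Fintype.card W → ∃ (S : Finset W) (f : W → V) (J : V → ℕ),
      #S = k ∧ (∀ a ∈ S, ∀ b ∈ S, ∃ p : T.Walk a b, ∀ x ∈ p.support, x ∈ S) ∧
      (∀ a ∈ S, f a ∈ U) ∧ Set.InjOn f S ∧ (∀ a ∈ S, ∀ b ∈ S, T.Adj a b → G.Adj (f a) (f b)) ∧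
      (∀ a ∈ S, J (f a) ≤ #{b ∈ S | T.Adj a b}) ∧ (∀ x ∉ S.image f, J x = 0) ∧
      ∀ X ⊆ U, #X ≤ 2 * m → d * #X ≤ #(G.nbhdIn U X \ S.image f) + ∑ x ∈ X, J x := by
    intro k hk
    induction k, hk using Nat.le_induction with
    | base =>
      intro _
      obtain ⟨u, hu⟩ := hU
      obtain ⟨w⟩ := hT.1.nonempty
      refine ⟨{w}, fun _ => u, fun _ => 0, by simp, ?_, by simpa using hu, by simp, by simp,
        by simp, by simp, ?_⟩
      · intro a ha b hb
        rw [mem_singleton] at ha hb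
        subst ha hb
        exact ⟨Walk.nil, by simp⟩
      · intro X hXU hX
        rcases X.eq_empty_or_nonempty with rfl | hne
        · simp
        have h1 : d * #X + 1 ≤ #(G.nbhdIn U X) := by
          rcases le_or_gt #X m with h | h
          · exact hsmall X hXU hne h
          · exact le_trans (by omega) (hlarge X hXU h hX)
        -- The `+ 1` in the expansion hypotheses pays for removing the root's image.
        have h2 := le_card_sdiff {u} (G.nbhdIn U X)
        simp only [image_singleton, sum_const_zero, card_singleton] at h2 ⊢
        omega
    | succ k hk ih =>
      intro hkW
      obtain ⟨S, f, J, hSk, hconn, hfU, hinj, hadj, hJdeg, hJ0, hexp⟩ := ih (by omega)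
      obtain ⟨a, ha⟩ : S.Nonempty := card_pos.1 (by omega)
      obtain ⟨b, hb⟩ : ∃ b, b ∉ S := by
        by_contra! h
        rw [(eq_univ_iff_forall.2 h), card_univ] at hSk
        omega
      obtain ⟨⟨⟨t, w⟩, htw⟩, -, ht, hw⟩ :=
        (hT.1.preconnected a b).some.exists_boundary_dart (S : Set W) ha hb
      simp only [mem_coe] at ht hw
      replace htw : T.Adj t w := htw
      have huniq : ∀ c ∈ S, T.Adj c w → c = t := fun c hc hcw => by
        obtain ⟨p, hp⟩ := hconn c hc t ht
        exact hT.2.eq_of_adj_of_adj (S := (S : Set W)) hw p hp hcw htw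
      -- The unembedded neighbour `w` of `t` leaves room for one more edge.
      have hJt : J (f t) < d := by
        have h1 : insert w {b ∈ S | T.Adj t b} ⊆ (Set.toFinite (T.neighborSet t)).toFinset := by
          intro x hx
          simp only [mem_insert, mem_filter] at hx
          simp only [Set.Finite.mem_toFinset, mem_neighborSet]
          rcases hx with rfl | hx
          · exact htw
          · exact hx.2
        have h2 := card_le_card h1
        rw [← Set.ncard_eq_toFinset_card, card_insert_of_notMem (by simp [hw])] at h2
        have := hJdeg t ht
        have := hdeg t
        omega
      obtain ⟨y, hyU, hyP, hty, hexp'⟩ := exists_extension_vertex hm (hfU t ht) hJt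
        (card_image_le.trans (by omega)) hlarge hexp
      have hfw : ∀ c ∈ S, Function.update f w y c = f c := fun c hc =>
        Function.update_of_ne (ne_of_mem_of_not_mem hc hw) _ _
      have hyf : ∀ c ∈ S, f c ≠ y := fun c hc h => hyP (h ▸ mem_image_of_mem f hc)
      have himg : (insert w S).image (Function.update f w y) = insert y (S.image f) := by
        rw [image_insert, Function.update_self, image_congr fun c hc => hfw c hc]
      refine ⟨insert w S, Function.update f w y, fun x => J x + (if x = f t then 1 else 0) +
        (if x = y then 1 else 0), by rw [card_insert_of_notMem hw, hSk], ?_, ?_, ?_, ?_, ?_, ?_,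
        himg ▸ hexp'⟩
      · have hto : ∀ c ∈ S, ∃ p : T.Walk c w, ∀ x ∈ p.support, x ∈ insert w S := by
          intro c hc
          obtain ⟨p, hp⟩ := hconn c hc t ht
          refine ⟨p.concat htw, fun x hx => ?_⟩
          rw [Walk.support_concat, List.mem_append, List.mem_singleton] at hx
          rcases hx with hx | rfl
          · exact mem_insert_of_mem (hp x hx)
          · exact mem_insert_self _ _
        intro a ha b hb
        rcases mem_insert.1 ha with rfl | ha' <;> rcases mem_insert.1 hb with rfl | hb'
        · exact ⟨Walk.nil, by simp⟩
        · obtain ⟨p, hp⟩ := hto b hb'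
          exact ⟨p.reverse, by simpa using hp⟩
        · exact hto a ha'
        · obtain ⟨p, hp⟩ := hconn a ha' b hb'
          exact ⟨p, fun x hx => mem_insert_of_mem (hp x hx)⟩
      · intro a ha
        rcases mem_insert.1 ha with rfl | ha
        · simpa using hyU
        · rw [hfw a ha]; exact hfU a ha
      · intro a ha b hb hab
        simp only [coe_insert, Set.mem_insert_iff, mem_coe] at ha hb
        rcases ha with rfl | ha <;> rcases hb with rfl | hb
        · rfl
        · rw [Function.update_self, hfw b hb] at hab
          exact absurd hab.symm (hyf b hb)
        · rw [Function.update_self, hfw a ha] at hab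
          exact absurd hab (hyf a ha)
        · rw [hfw a ha, hfw b hb] at hab
          exact hinj ha hb hab
      · intro a ha b hb hab
        rcases mem_insert.1 ha with rfl | ha' <;> rcases mem_insert.1 hb with rfl | hb'
        · exact absurd rfl hab.ne
        · rw [Function.update_self, hfw b hb', huniq b hb' hab.symm]
          exact hty.symm
        · rw [Function.update_self, hfw a ha', huniq a ha' hab]
          exact hty
        · rw [hfw a ha', hfw b hb']
          exact hadj a ha' b hb' hab
      · intro a ha
        rcases mem_insert.1 ha with rfl | ha
        · rw [Function.update_self]
          beta_reduce
          rw [hJ0 y hyP, if_neg (hyf t ht).symm, if_pos rfl]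
          refine card_pos.2 ⟨t, ?_⟩
          simp [ht, htw.symm]
        · rw [hfw a ha]
          beta_reduce
          rw [if_neg (hyf a ha), filter_insert]
          have := hJdeg a ha
          split_ifs with h1 h2 h2
          · rw [card_insert_of_notMem (by simp [hw])]
            omega
          · exact absurd (hinj ha ht h1 ▸ htw) h2
          · rw [card_insert_of_notMem (by simp [hw])]
            omega
          · omega
      · intro x hx
        rw [himg, mem_insert, not_or] at hx
        beta_reduce
        rw [hJ0 x hx.2, if_neg hx.1, if_neg]
        rintro rfl
        exact hx.2 (mem_image_of_mem f ht)
  obtain ⟨w⟩ := hT.1.nonempty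
  obtain ⟨S, f, J, hS, -, -, hinj, hadj, -⟩ := key _ (Fintype.card_pos_iff.2 ⟨w⟩) le_rfl
  have hS' : S = univ := (card_eq_iff_eq_univ S).1 hS
  subst hS'
  exact ⟨⟨⟨f, fun {a b} h => hadj a (mem_univ a) b (mem_univ b) h⟩,
    fun a b h => hinj (by simp) (by simp) h⟩⟩

/-- If every `m`-subset of `U` has a large closed neighbourhood in `U`, then the graph contains
every tree with at most `n + 1` vertices and maximum degree at most `d`. -/
theorem SimpleGraph.IsTree.isContained_of_card_union_nbhdIn {W : Type*} [Fintype W]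
    {T : SimpleGraph W} (hT : T.IsTree) {d m n : ℕ} (hm : 1 ≤ m)
    (hcard : Fintype.card W ≤ n + 1) (hdeg : ∀ v, (T.neighborSet v).ncard ≤ d) (hU : m < #U)
    (h : ∀ X ⊆ U, #X = m → n + 1 + (2 * d + 3) * m ≤ #(X ∪ G.nbhdIn U X)) :
    T.IsContained G := by
  classical
  have hge : ∀ X ⊆ U, m ≤ #X → n + 1 + (2 * d + 3) * m ≤ #(X ∪ G.nbhdIn U X) := by
    intro X hXU hX
    obtain ⟨Y, hYX, hY⟩ := exists_subset_card_eq hX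
    exact (h Y (hYX.trans hXU) hY).trans
      (card_le_card (union_subset_union hYX (SimpleGraph.nbhdIn_mono hYX)))
  -- Delete a largest non-expanding `B`. A non-expanding `X` in the rest would make `B ∪ X`
  -- non-expanding: this contradicts maximality if its size is at most `m`, and the large closed
  -- neighbourhoods otherwise.
  obtain ⟨B, hB, hmax⟩ := exists_max_image
    {B ∈ U.powerset | #B ≤ m ∧ #(G.nbhdIn U B \ B) ≤ d * #B} card
    ⟨∅, by
      have h0 : G.nbhdIn U ∅ = ∅ := by simp [SimpleGraph.nbhdIn]
      simp [h0]⟩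
  simp only [mem_filter, mem_powerset] at hB hmax
  obtain ⟨hBU, hBm, hBd⟩ := hB
  have hsub : ∀ X, G.nbhdIn (U \ B) X = G.nbhdIn U X \ B := by
    intro X; ext y
    simp only [SimpleGraph.mem_nbhdIn, mem_sdiff]
    tauto
  have hcardUB := le_card_sdiff B U
  refine hT.isContained_of_expansion (G := G) (U := U \ B) hm hcard hdeg
    (card_pos.1 (by omega)) ?_ ?_
  · intro X hXU hne hXm
    by_contra! hlt
    rw [hsub] at hlt
    have hdisj : Disjoint B X := (subset_sdiff.1 hXU).2.symm
    have hXU' : X ⊆ U := hXU.trans sdiff_subset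
    have hBX : #(B ∪ X) = #B + #X := card_union_of_disjoint hdisj
    have hXpos := hne.card_pos
    have h1 : #(G.nbhdIn U (B ∪ X) \ (B ∪ X)) ≤ d * #(B ∪ X) := by
      calc _ ≤ #((G.nbhdIn U B \ B) ∪ (G.nbhdIn U X \ B)) := by
            refine card_le_card ?_
            rw [SimpleGraph.nbhdIn_union]
            grind
        _ ≤ _ := card_union_le _ _
        _ ≤ d * #B + d * #X := by omega
        _ = _ := by rw [hBX, mul_add]
    rcases le_or_gt #(B ∪ X) m with h2 | h2
    · have := hmax _ ⟨union_subset hBU hXU', h2, h1⟩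
      omega
    · have h3 := hge (B ∪ X) (union_subset hBU hXU') h2.le
      have h4 : #(B ∪ X ∪ G.nbhdIn U (B ∪ X)) ≤ #(B ∪ X) + d * #(B ∪ X) := by
        rw [← union_sdiff_self_eq_union]
        exact (card_union_le _ _).trans (by omega)
      have h5 : d * #(B ∪ X) ≤ d * (2 * m) := Nat.mul_le_mul_left d (by omega)
      have h6 : (2 * d + 3) * m = d * (2 * m) + 3 * m := by ring
      omega
  · intro X hXU hmX hX2
    have h1 := hge X (hXU.trans sdiff_subset) hmX.le
    have h2 := card_union_le X (G.nbhdIn U X)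
    have h3 := le_card_sdiff B (G.nbhdIn U X)
    -- Of the slack `(2 * d + 3) * m`, `2 * m` pays for `X`, `m` for `B`, and the rest for `d * #X`.
    have h5 : d * #X ≤ d * (2 * m) := Nat.mul_le_mul_left d hX2
    have h6 : (2 * d + 3) * m = d * (2 * m) + 3 * m := by ring
    rw [hsub]
    omega

/-- If `G` does not contain a bounded degree tree with `n + 1` vertices inside a set of more than
about `j * n` vertices, then it contains `j + 1` disjoint sets of size `m` without edges between
them. -/
theorem SimpleGraph.IsTree.exists_disjoint_not_adj {W : Type*} [Fintype W]
    {T : SimpleGraph W} (hT : T.IsTree) {d m n : ℕ} (hm : 1 ≤ m)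
    (hcard : Fintype.card W ≤ n + 1) (hdeg : ∀ v, (T.neighborSet v).ncard ≤ d)
    (hfree : ¬ T.IsContained G) (j : ℕ) (hU : j * (n + 1 + (2 * d + 3) * m) + m ≤ #U) :
    ∃ S : Fin (j + 1) → Finset V, (∀ i, S i ⊆ U ∧ #(S i) = m) ∧
      ∀ i k, i ≠ k → Disjoint (S i) (S k) ∧ ∀ x ∈ S i, ∀ y ∈ S k, ¬ G.Adj x y := by
  induction j generalizing U with
  | zero =>
    obtain ⟨S, hSU, hS⟩ := exists_subset_card_eq (s := U) (n := m) (by omega)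
    exact ⟨fun _ => S, fun _ => ⟨hSU, hS⟩, fun i k hik => absurd (by omega) hik⟩
  | succ j ih =>
    set K := n + 1 + (2 * d + 3) * m with hK
    have hsucc : (j + 1) * K = j * K + K := by ring
    -- Removing `X` and its neighbours costs fewer than `K` vertices, and every later set avoids
    -- both.
    obtain ⟨X, hXU, hXm, hX⟩ : ∃ X ⊆ U, #X = m ∧ #(X ∪ G.nbhdIn U X) < K := by
      by_contra! hcon
      exact hfree (hT.isContained_of_card_union_nbhdIn hm hcard hdeg (by omega) hcon)
    obtain ⟨S, hS, hSS⟩ := ih (U := U \ (X ∪ G.nbhdIn U X))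
      (by have := le_card_sdiff (X ∪ G.nbhdIn U X) U; omega)
    have hXS : ∀ i, ∀ y ∈ S i, y ∉ X ∧ ∀ x ∈ X, ¬ G.Adj x y := by
      intro i y hy
      have h1 := (hS i).1 hy
      rw [mem_sdiff, mem_union, not_or, SimpleGraph.mem_nbhdIn] at h1
      exact ⟨h1.2.1, fun x hx hxy => h1.2.2 ⟨h1.1, x, hx, hxy⟩⟩
    refine ⟨Fin.cons X S, ?_, ?_⟩
    · intro i
      refine Fin.cases ?_ (fun i => ?_) i
      · exact ⟨hXU, hXm⟩
      · exact ⟨(hS i).1.trans sdiff_subset, (hS i).2⟩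
    · intro i k
      refine Fin.cases ?_ (fun i => ?_) i <;> refine Fin.cases ?_ (fun k => ?_) k
      · exact fun h => absurd rfl h
      · intro _
        simp only [Fin.cons_zero, Fin.cons_succ]
        exact ⟨disjoint_right.2 fun {y} hy => (hXS k y hy).1, fun x hx y hy => (hXS k y hy).2 x hx⟩
      · intro _
        simp only [Fin.cons_zero, Fin.cons_succ]
        exact ⟨(disjoint_right.2 fun {y} hy => (hXS i y hy).1).symm,
          fun y hy x hx h => (hXS i y hy).2 x hx h.symm⟩
      · intro h
        simp only [Fin.cons_succ]
        exact hSS i k fun hik => h (by rw [hik])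

end TreeEmbedding

/-! ### From crossing cliques to the Ramsey property -/

/-- If in `G` all families of `r + 1` disjoint `m`-subsets of `U` have a crossing clique, then `G`
is Ramsey for `K_{r+1}` against bounded degree trees with `n` edges. -/
lemma ramseyArrowTrees_of_crossing_cliques {V : Type*} {G : SimpleGraph V}
    {U : Finset V} {r n d m : ℕ} (hm : 1 ≤ m) (hU : r * (n + 1 + (2 * d + 3) * m) + m ≤ #U)
    (hG : ∀ S : Fin (r + 1) → Finset V, (∀ i, S i ⊆ U ∧ #(S i) = m) →
      (Pairwise fun i j => Disjoint (S i) (S j)) →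
      ∃ φ : Fin (r + 1) → V, (∀ i, φ i ∈ S i) ∧ ∀ i j, i ≠ j → G.Adj (φ i) (φ j)) :
    RamseyArrowTrees G (SimpleGraph.completeGraph (Fin (r + 1))) n d := by
  classical
  intro W _ T hT c
  have := Fintype.ofFinite W
  by_cases hred : T.IsContained (c.labelGraph EdgeColour.red)
  · exact Or.inr hred
  left
  have hcard : Fintype.card W ≤ n + 1 := by
    have h1 := hT.isTree.card_edgeFinset
    have h2 := hT.ncard_edgeSet
    rw [← SimpleGraph.coe_edgeFinset, Set.ncard_coe_finset] at h2
    omega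
  obtain ⟨S, hS, hSS⟩ :=
    hT.isTree.exists_disjoint_not_adj hm hcard hT.ncard_neighborSet_le hred r hU
  obtain ⟨φ, hφS, hφ⟩ := hG S hS fun i j hij => (hSS i j hij).1
  have hblue : ∀ i j, i ≠ j → (c.labelGraph EdgeColour.blue).Adj (φ i) (φ j) := by
    intro i j hij
    have h1 := (hSS i j hij).2 _ (hφS i) _ (hφS j)
    rw [SimpleGraph.EdgeLabeling.labelGraph_adj] at h1 ⊢
    refine ⟨hφ i j hij, ?_⟩
    cases hc : c ⟨s(φ i, φ j), hφ i j hij⟩ with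
    | blue => rfl
    | red => exact absurd ⟨hφ i j hij, hc⟩ h1
  refine ⟨⟨⟨φ, fun {i j} hij => hblue i j hij⟩, fun i j hij => ?_⟩⟩
  by_contra h
  exact (hblue i j h).ne hij

/-! ### Clique counts, the union bound and the choice of constants -/

/-- The exponent of `x` on the right is `k - (k - 1) * k / s`, at least `1` because `k ≤ s`.
Equality at `k = s` explains the threshold `n^(-2/(r+1))`. -/
lemma le_pow_mul_rpow_pow_choose {x : ℝ} (hx : 1 ≤ x) {k s : ℕ} (hk : 1 ≤ k) (hks : k ≤ s) :
    x ≤ x ^ k * (x ^ (-(2 : ℝ) / s)) ^ k.choose 2 := by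
  have hx0 : 0 < x := by linarith
  have hs : (0 : ℝ) < s := by exact_mod_cast (by omega : 0 < s)
  rw [← Real.rpow_natCast x k, ← Real.rpow_natCast (x ^ _), ← Real.rpow_mul hx0.le,
    ← Real.rpow_add hx0, Nat.cast_choose_two]
  conv_lhs => rw [← Real.rpow_one x]
  refine Real.rpow_le_rpow_of_exponent_le hx ?_
  have h1 : (1 : ℝ) ≤ k := by exact_mod_cast hk
  have h2 : (k : ℝ) ≤ s := by exact_mod_cast hks
  have h3 : -(2 : ℝ) / s * (k * (k - 1) / 2) = -((k - 1) * (k / s)) := by ring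
  have h4 : (k : ℝ) / s ≤ 1 := (div_le_one hs).2 h2
  rw [h3]
  nlinarith

/-- If `p ≥ C x ^ (-2 / s)` then the expected number of crossing `k`-cliques between sets of size
at least `δ x` is at least linear in `x`. -/
lemma mul_le_pow_mul_pow_choose {x δ C A m p : ℝ} (hx : 1 ≤ x) (hδ0 : 0 < δ) (hδ1 : δ ≤ 1)
    {k s : ℕ} (hk : 2 ≤ k) (hks : k ≤ s) (hC1 : 1 ≤ C) (hC : A ≤ δ ^ s * C) (hm : δ * x ≤ m)
    (hp : C * x ^ (-(2 : ℝ) / s) ≤ p) : A * x ≤ m ^ k * p ^ k.choose 2 := by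
  have hx0 : 0 < x := by linarith
  have hr : 0 < x ^ (-(2 : ℝ) / s) := Real.rpow_pos_of_pos hx0 _
  have hm0 : 0 ≤ m := le_trans (by positivity) hm
  have hCk : C ≤ C ^ k.choose 2 := le_self_pow₀ hC1 (Nat.choose_pos hk).ne'
  have hδk : δ ^ s ≤ δ ^ k := pow_le_pow_of_le_one hδ0.le hδ1 hks
  calc A * x ≤ (δ ^ s * C) * x := by gcongr
    _ ≤ (δ ^ k * C ^ k.choose 2) * (x ^ k * (x ^ (-(2 : ℝ) / s)) ^ k.choose 2) := by
        gcongr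
        exact le_pow_mul_rpow_pow_choose hx (by omega) hks
    _ = (δ * x) ^ k * (C * x ^ (-(2 : ℝ) / s)) ^ k.choose 2 := by
        rw [mul_pow, mul_pow]; ring
    _ ≤ _ := by gcongr

/-- The union bound over all families of disjoint `m`-subsets of `U`. -/
lemma SimpleGraph.binomialRandom_not_ramseyArrowTrees_le {V : Type*} [Fintype V] {U : Finset V}
    {r n d m : ℕ} (hr : 1 ≤ r) (hm : 1 ≤ m) (hU : r * (n + 1 + (2 * d + 3) * m) + m ≤ #U)
    {p : unitInterval} {L : ℝ} (hp0 : 0 < (p : ℝ)) (hL : 0 < L)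
    (hLk : ∀ k, 2 ≤ k → k ≤ r + 1 → L ≤ (m : ℝ) ^ k * (p : ℝ) ^ k.choose 2) :
    SimpleGraph.binomialRandom V p
      {G | RamseyArrowTrees G (SimpleGraph.completeGraph (Fin (r + 1))) n d}ᶜ ≤
      ENNReal.ofReal (Real.exp ((r + 1) * #U - L / 2 ^ (r + 1 + 2))) := by
  classical
  let 𝒯 : Finset (Fin (r + 1) → Finset V) := {S ∈ Fintype.piFinset fun _ => U.powerset |
    (∀ i, #(S i) = m) ∧ Pairwise fun i j => Disjoint (S i) (S j)}
  have hsub : {G : SimpleGraph V |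
      RamseyArrowTrees G (SimpleGraph.completeGraph (Fin (r + 1))) n d}ᶜ ⊆ ⋃ S ∈ 𝒯,
        {G | ¬ ∃ φ : Fin (r + 1) → V, (∀ i, φ i ∈ S i) ∧ ∀ i j, i ≠ j → G.Adj (φ i) (φ j)} := by
    intro G hG
    by_contra hcon
    refine hG (ramseyArrowTrees_of_crossing_cliques hm hU fun S hS hdisj => ?_)
    by_contra hno
    refine hcon (Set.mem_biUnion (x := S) ?_ hno)
    simp only [𝒯, coe_filter, Fintype.mem_piFinset, mem_powerset, Set.mem_ofPred_eq]
    exact ⟨fun i => (hS i).1, fun i => (hS i).2, hdisj⟩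
  have hcard𝒯 : (#𝒯 : ℝ) ≤ Real.exp ((r + 1) * #U) := by
    have h1 : #𝒯 ≤ (2 ^ #U) ^ (r + 1) := (card_filter_le _ _).trans (by simp)
    have h2 : (2 : ℝ) ≤ Real.exp 1 := by
      have := Real.add_one_le_exp (1 : ℝ)
      linarith
    calc (#𝒯 : ℝ) ≤ (2 ^ #U) ^ (r + 1) := by exact_mod_cast h1
      _ ≤ (Real.exp 1 ^ #U) ^ (r + 1) := by gcongr
      _ = Real.exp ((r + 1) * #U) := by
        rw [← pow_mul, ← Real.exp_nat_mul]
        push_cast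
        ring_nf
  calc _ ≤ ∑ S ∈ 𝒯, SimpleGraph.binomialRandom V p
        {G | ¬ ∃ φ : Fin (r + 1) → V, (∀ i, φ i ∈ S i) ∧ ∀ i j, i ≠ j → G.Adj (φ i) (φ j)} :=
        (MeasureTheory.measure_mono hsub).trans (MeasureTheory.measure_biUnion_finset_le _ _)
    _ ≤ #𝒯 • ENNReal.ofReal (Real.exp (-(L / 2 ^ (r + 1 + 2)))) := by
        refine sum_le_card_nsmul _ _ _ fun S hS => ?_
        simp only [𝒯, mem_filter] at hS
        exact SimpleGraph.binomialRandom_no_crossing_clique_le hS.2.2 hS.2.1 hp0 hL hm (by omega)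
          hLk
    _ = ENNReal.ofReal (#𝒯 * Real.exp (-(L / 2 ^ (r + 1 + 2)))) := by
        rw [nsmul_eq_mul, ENNReal.ofReal_mul (by positivity), ENNReal.ofReal_natCast]
    _ ≤ _ := by
        refine ENNReal.ofReal_le_ofReal ?_
        rw [sub_eq_add_neg, Real.exp_add]
        gcongr

theorem theorem1p2 (r D : ℕ) (hr : 2 ≤ r) (hD : 2 ≤ D) (ε : ℝ) (hε : 0 < ε) :
    ∃ C : ℝ, 0 < C ∧
      ∀ (p : ℕ → unitInterval) (N : ℕ → ℕ),
        (∀ᶠ n : ℕ in Filter.atTop, C * (n : ℝ) ^ (-(2 : ℝ) / ((r : ℝ) + 1)) ≤ (p n : ℝ)) →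
        (∀ᶠ n : ℕ in Filter.atTop, (r : ℝ) * (n : ℝ) + ε * (n : ℝ) ≤ (N n : ℝ)) →
        Filter.Tendsto
          (fun n : ℕ => SimpleGraph.binomialRandom (Fin (N n)) (p n)
            {G : SimpleGraph (Fin (N n)) |
              RamseyArrowTrees G (SimpleGraph.completeGraph (Fin (r + 1))) n D})
          Filter.atTop (nhds 1) := by
  -- `c` is the coefficient of `m` in the number of vertices the tree side requires. Taking `c * δ ≤
  -- ε / 2` lets half of `ε * n` absorb `c * δ * n`; the other half absorbs the constant `r + c` for
  -- large `n`.
  set c : ℝ := r * (2 * D + 3) + 1 with hc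
  have hc0 : 0 < c := by positivity
  set δ : ℝ := min 1 (ε / (2 * c)) with hδ
  have hδ0 : 0 < δ := lt_min one_pos (by positivity)
  have hδ1 : δ ≤ 1 := min_le_left _ _
  have hδc : c * δ ≤ ε / 2 := by
    have : δ ≤ ε / (2 * c) := min_le_right _ _
    calc c * δ ≤ c * (ε / (2 * c)) := by gcongr
      _ = ε / 2 := by field_simp
  -- Chosen so that `A * n / 2 ^ (r + 3)` exceeds the union bound exponent `(r + 1) * #U ≤ (r + 1) *
  -- (r + ε + 1) * n` by at least `n`.
  set A : ℝ := 2 ^ (r + 1 + 2) * ((r + 1) * (r + ε + 1) + 1) with hA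
  have hA0 : 0 < A := by positivity
  refine ⟨max 1 (A / δ ^ (r + 1)), by positivity, fun p N hp hN => ?_⟩
  have hCA : A ≤ δ ^ (r + 1) * max 1 (A / δ ^ (r + 1)) := by
    calc A = δ ^ (r + 1) * (A / δ ^ (r + 1)) := by field_simp
      _ ≤ _ := by gcongr; exact le_max_right _ _
  have hbad : ∀ᶠ n : ℕ in Filter.atTop, SimpleGraph.binomialRandom (Fin (N n)) (p n)
      {G : SimpleGraph (Fin (N n)) |
        RamseyArrowTrees G (SimpleGraph.completeGraph (Fin (r + 1))) n D}ᶜ ≤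
      ENNReal.ofReal (Real.exp (-(n : ℝ))) := by
    filter_upwards [hp, hN, Filter.eventually_ge_atTop 1,
      Filter.eventually_ge_atTop ⌈2 * (r + c) / ε⌉₊] with n hpn hNn hn1 hn
    have hx1 : (1 : ℝ) ≤ n := by exact_mod_cast hn1
    have hnε : r + c ≤ ε / 2 * n := by
      have h1 := Nat.ceil_le.1 hn
      rw [div_le_iff₀ hε] at h1
      linarith
    set m := ⌈δ * n⌉₊ with hm
    have hmδ : δ * n ≤ m := Nat.le_ceil _
    have hmlt : (m : ℝ) < δ * n + 1 := Nat.ceil_lt_add_one (by positivity)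
    have hm1 : 1 ≤ m := Nat.ceil_pos.2 (by positivity)
    -- `N n` has no upper bound, so the argument is confined to a set of linear size to keep the
    -- union bound exponential in `n`.
    obtain ⟨U, -, hU⟩ := exists_subset_card_eq (s := (univ : Finset (Fin (N n))))
      (n := ⌈(r : ℝ) * n + ε * n⌉₊) (by
        rw [card_univ, Fintype.card_fin]
        exact Nat.ceil_le.2 hNn)
    have hUge : (r : ℝ) * n + ε * n ≤ #U := hU ▸ Nat.le_ceil _
    have hUlt : (#U : ℝ) < r * n + ε * n + 1 := hU ▸ Nat.ceil_lt_add_one (by positivity)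
    have hUm : r * (n + 1 + (2 * D + 3) * m) + m ≤ #U := by
      have h1 : (r : ℝ) * (n + 1 + (2 * D + 3) * m) + m ≤ #U := by
        calc (r : ℝ) * (n + 1 + (2 * D + 3) * m) + m = r * n + r + c * m := by rw [hc]; ring
          _ ≤ r * n + r + c * (δ * n + 1) := by gcongr
          _ = r * n + (r + c) + (c * δ) * n := by ring
          _ ≤ r * n + ε / 2 * n + ε / 2 * n := by gcongr
          _ = r * n + ε * n := by ring
          _ ≤ _ := hUge
      exact_mod_cast h1
    have hp0 : 0 < (p n : ℝ) := lt_of_lt_of_le (by positivity) hpn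
    refine (SimpleGraph.binomialRandom_not_ramseyArrowTrees_le (L := A * n) (by omega) hm1 hUm hp0
      (by positivity) fun k hk hkr => ?_).trans
      (ENNReal.ofReal_le_ofReal (Real.exp_le_exp.2 ?_))
    · exact mul_le_pow_mul_pow_choose hx1 hδ0 hδ1 hk hkr (le_max_left _ _) hCA hmδ
        (by push_cast; exact hpn)
    · have h1 : A * n / 2 ^ (r + 1 + 2) = ((r + 1) * (r + ε + 1) + 1) * n := by
        rw [hA]; field_simp
      have h2 : (r + 1 : ℝ) * #U ≤ (r + 1) * ((r + ε + 1) * n) := by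
        gcongr
        linarith
      rw [h1]
      linarith
  have hlim : Filter.Tendsto (fun n : ℕ => 1 - ENNReal.ofReal (Real.exp (-(n : ℝ))))
      Filter.atTop (nhds 1) := by
    have h1 : Filter.Tendsto (fun n : ℕ => ENNReal.ofReal (Real.exp (-(n : ℝ)))) Filter.atTop
        (nhds 0) := by
      rw [← ENNReal.ofReal_zero]
      exact ENNReal.tendsto_ofReal
        (Real.tendsto_exp_neg_atTop_nhds_zero.comp tendsto_natCast_atTop_atTop)
    simpa using ENNReal.Tendsto.sub tendsto_const_nhds h1 (Or.inl ENNReal.one_ne_top)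
  refine tendsto_of_tendsto_of_tendsto_of_le_of_le' hlim tendsto_const_nhds ?_
    (Filter.Eventually.of_forall fun n => MeasureTheory.prob_le_one)
  filter_upwards [hbad] with n hn
  rw [tsub_le_iff_right]
  calc (1 : ENNReal) = SimpleGraph.binomialRandom (Fin (N n)) (p n) Set.univ :=
        MeasureTheory.measure_univ.symm
    _ ≤ _ := by
        rw [← Set.union_compl_self]
        exact (MeasureTheory.measure_union_le _ _).trans (add_le_add_right hn _)
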